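/- Let $\ell$ be an odd prime. For a number field $K$ put $\mathcal R_K=\mathbb Z_\ell\otimes_{\mathbb Z}K^\times$ and, for a finite place $v$ of $K$ with completion $K_v$, put $\mathcal R_{K_v}=\varprojlim_n K_v^\times/K_v^{\times\,\ell^n}$; let $\mu_{K_v}$ be the image in $\mathcal R_{K_v}$ of the group of roots of unity of $\ell$-power order of $K_v$. Let $\mathcal D'_K$ be the free $\mathbb Z_\ell$-module on the primes of $K$ not dividing $\ell$, let $\mathcal R_K^{bp}$ be the submodule of pseudo-infinitesimal elements, i.e. of those $x\in\mathcal R_K$ whose image in $\mathcal R_{K_v}$ lies in $\mu_{K_v}$ for every place $v\mid\ell$, let $\mathcal P_K^{bp}\subset\mathcal D'_K$ be the module of the principal divisors of elements of $\mathcal R_K^{bp}$, and let $\mathcal C\ell_K^{bp}=\mathcal D'_K/\mathcal P_K^{bp}$ be the group of pseudo-infinitesimal classes of $K$. The Leopoldt conjecture for $\ell$ and $K$ is the assertion that the natural map $\mathbb Z_\ell\otimes_{\mathbb Z}E_K\to\prod_{v\mid\ell}\mathcal R_{K_v}$ is injective, where $E_K$ is the group of units of the ring of integers of $K$. Let $L/K$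 be a finite Galois extension of number fields whose Galois group is an $\ell$-group, and assume the Leopoldt conjecture for $\ell$ and $L$. Let $\mathrm{Cap}^{bp}_{L/K}$ be the kernel of the map $\mathcal C\ell_K^{bp}\to\mathcal C\ell_L^{bp}$ induced by extension of divisors (ideals) from $K$ to $L$. (i) If $K$ does not contain the $\ell$-th roots of unity, then $\mathrm{Cap}^{bp}_{L/K}=1$. (ii) If $K$ contains the $\ell$-th roots of unity and $L$ is a finite layer of the cyclotomic $\mathbb Z_\ell$-extension of $K$, then $\mathrm{Cap}^{bp}_{L/K}=1$. -/

import Mathlib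

open scoped TensorProduct NumberField
open IsDedekindDomain

noncomputable section

namespace PseudoInfinitesimal

/-! ### `ℓ`-adic tensor products and completions of multiplicative groups -/

/-- `ℤ_ℓ ⊗_ℤ A` for a commutative group `A` written multiplicatively. -/
abbrev AdicTensor (ℓ : ℕ) [Fact ℓ.Prime] (A : Type*) [CommGroup A] : Type _ :=
  ℤ_[ℓ] ⊗[ℤ] Additive A

/-- The `ℤ_ℓ`-linear map `ℤ_ℓ ⊗ A → ℤ_ℓ ⊗ B` induced by a homomorphism `A → B`. -/
def tensorMap (ℓ : ℕ) [Fact ℓ.Prime] {A B : Type*} [CommGroup A] [CommGroup B] (f : A →* B) :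
    AdicTensor ℓ A →ₗ[ℤ_[ℓ]] AdicTensor ℓ B :=
  (MonoidHom.toAdditive f).toIntLinearMap.baseChange ℤ_[ℓ]

/-- The `ℓ`-adic completion `lim A / A^(ℓ^n)` of a commutative group `A`, with its natural
`ℤ_ℓ`-module structure: it is written as `lim (ℤ_ℓ ⊗ A) / ℓ^n (ℤ_ℓ ⊗ A)`, the quotient
`(ℤ_ℓ ⊗ A) / ℓ^n (ℤ_ℓ ⊗ A) = (ℤ / ℓ^n) ⊗ A` being `A / A^(ℓ^n)`. -/
abbrev AdicGroupCompletion (ℓ : ℕ) [Fact ℓ.Prime] (A : Type*) [CommGroup A] : Type _ :=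
  AdicCompletion (Ideal.span {(ℓ : ℤ_[ℓ])}) (AdicTensor ℓ A)

/-- The natural map `ℤ_ℓ ⊗ A → lim A / A^(ℓ^n)`. -/
def toCompletion (ℓ : ℕ) [Fact ℓ.Prime] (A : Type*) [CommGroup A] :
    AdicTensor ℓ A →ₗ[ℤ_[ℓ]] AdicGroupCompletion ℓ A :=
  AdicCompletion.of (Ideal.span {(ℓ : ℤ_[ℓ])}) (AdicTensor ℓ A)

/-- Functoriality of the `ℓ`-adic completion. -/
def completionMap (ℓ : ℕ) [Fact ℓ.Prime] {A B : Type*} [CommGroup A] [CommGroup B] (f : A →* B) :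
    AdicGroupCompletion ℓ A →ₗ[ℤ_[ℓ]] AdicGroupCompletion ℓ B :=
  (AdicCompletion.map (Ideal.span {(ℓ : ℤ_[ℓ])}) (tensorMap ℓ f)).restrictScalars ℤ_[ℓ]

theorem completionMap_toCompletion (ℓ : ℕ) [Fact ℓ.Prime] {A B : Type*} [CommGroup A]
    [CommGroup B] (f : A →* B) (x : AdicTensor ℓ A) :
    completionMap ℓ f (toCompletion ℓ A x) = toCompletion ℓ B (tensorMap ℓ f x) :=
  AdicCompletion.map_of _ _ _

theorem tensorMap_comp (ℓ : ℕ) [Fact ℓ.Prime] {A B C : Type*} [CommGroup A] [CommGroup B]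
    [CommGroup C] (g : B →* C) (f : A →* B) (x : AdicTensor ℓ A) :
    tensorMap ℓ g (tensorMap ℓ f x) = tensorMap ℓ (g.comp f) x := by
  induction x using TensorProduct.induction_on with
  | zero => simp
  | tmul a b => rfl
  | add x y hx hy => simp only [map_add, hx, hy]

/-- The `ℤ_ℓ`-submodule of `lim A / A^(ℓ^n)` generated by the image of the elements of
`ℓ`-power order of `A`. -/
def torsionImage (ℓ : ℕ) [Fact ℓ.Prime] (A : Type*) [CommGroup A] :
    Submodule ℤ_[ℓ] (AdicGroupCompletion ℓ A) :=
  Submodule.span ℤ_[ℓ]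
    {y | ∃ ζ : A, (∃ n : ℕ, ζ ^ ℓ ^ n = 1) ∧
      y = toCompletion ℓ A ((1 : ℤ_[ℓ]) ⊗ₜ[ℤ] Additive.ofMul ζ)}

theorem completionMap_mem_torsionImage (ℓ : ℕ) [Fact ℓ.Prime] {A B : Type*} [CommGroup A]
    [CommGroup B] (f : A →* B) {y : AdicGroupCompletion ℓ A} (hy : y ∈ torsionImage ℓ A) :
    completionMap ℓ f y ∈ torsionImage ℓ B := by
  suffices h : torsionImage ℓ A ≤ (torsionImage ℓ B).comap (completionMap ℓ f) from h hy
  refine Submodule.span_le.2 ?_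
  rintro _ ⟨ζ, ⟨n, hn⟩, rfl⟩
  refine Submodule.subset_span ⟨f ζ, ⟨n, by rw [← map_pow, hn, map_one]⟩, ?_⟩
  rw [completionMap_toCompletion]
  rfl

/-! ### Places, semi-localization and the Leopoldt conjecture -/

section Field

variable (ℓ : ℕ) [Fact ℓ.Prime] (K : Type*) [Field K] [NumberField K]

/-- The finite place `v` divides `ℓ`. -/
def DividesEll (v : HeightOneSpectrum (𝓞 K)) : Prop := (ℓ : 𝓞 K) ∈ v.asIdeal

/-- `R_K = ℤ_ℓ ⊗ Kˣ`. -/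
abbrev RGlob : Type _ := AdicTensor ℓ Kˣ

/-- `R_{K_v} = lim K_vˣ / (K_vˣ)^(ℓ^n)`, where `K_v` is the completion of `K` at `v`. -/
abbrev RLoc (v : HeightOneSpectrum (𝓞 K)) : Type _ := AdicGroupCompletion ℓ (v.adicCompletion K)ˣ

/-- The embedding `Kˣ → K_vˣ`. -/
def unitsEmbedding (v : HeightOneSpectrum (𝓞 K)) : Kˣ →* (v.adicCompletion K)ˣ :=
  Units.map (algebraMap K (v.adicCompletion K) : K →* v.adicCompletion K)

/-- The localization map `R_K → R_{K_v}`. -/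
def localization (v : HeightOneSpectrum (𝓞 K)) : RGlob ℓ K →ₗ[ℤ_[ℓ]] RLoc ℓ K v :=
  toCompletion ℓ (v.adicCompletion K)ˣ ∘ₗ tensorMap ℓ (unitsEmbedding K v)

/-- The semi-localization map `s_ℓ : R_K → ∏_{v ∣ ℓ} R_{K_v}`. -/
def semiLocalization :
    RGlob ℓ K →ₗ[ℤ_[ℓ]] ((v : {v : HeightOneSpectrum (𝓞 K) // DividesEll ℓ K v}) → RLoc ℓ K v.1) :=
  LinearMap.pi fun v => localization ℓ K v.1

/-- The Leopoldt conjecture for the prime `ℓ` and the number field `K`: the natural map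
`ℤ_ℓ ⊗ E_K → ∏_{v ∣ ℓ} R_{K_v}` is injective, `E_K` being the group of units of `K`. -/
def LeopoldtConjecture : Prop :=
  Function.Injective
    (semiLocalization ℓ K ∘ₗ tensorMap ℓ (Units.map (algebraMap (𝓞 K) K : 𝓞 K →* K)))

/-- The subgroup `R_K^bp` of pseudo-infinitesimal elements of `R_K`: those which are roots of
unity in `R_{K_v}` at all places `v` dividing `ℓ`. -/
def pseudoInfinitesimals : Submodule ℤ_[ℓ] (RGlob ℓ K) :=
  (Submodule.pi Set.univ fun v : {v : HeightOneSpectrum (𝓞 K) // DividesEll ℓ K v} =>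
    torsionImage ℓ (v.1.adicCompletion K)ˣ).comap (semiLocalization ℓ K)

/-! ### Divisors prime to `ℓ` and pseudo-infinitesimal classes -/

/-- `D'_K = ℤ_ℓ ⊗ Id'_K`: the free `ℤ_ℓ`-module on the primes of `K` not dividing `ℓ`. -/
abbrev Divisors : Type _ := {v : HeightOneSpectrum (𝓞 K) // ¬ DividesEll ℓ K v} →₀ ℤ_[ℓ]

/-- The normalized `v`-adic order `Kˣ → ℤ`. -/
def ord (v : HeightOneSpectrum (𝓞 K)) : Additive Kˣ →+ ℤ :=
  -(MonoidHom.toAdditiveLeft v.valuationOfNeZero)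

theorem valuation_eq_exp_ord (v : HeightOneSpectrum (𝓞 K)) (x : Kˣ) :
    v.valuation K (x : K) = WithZero.exp (-(ord K v (Additive.ofMul x))) := by
  rw [← HeightOneSpectrum.valuationOfNeZero_eq]
  simp [ord, WithZero.exp]

theorem ord_finite (x : Additive Kˣ) : {v | ord K v x ≠ 0}.Finite := by
  have h1 := HeightOneSpectrum.Support.finite (𝓞 K) ((x.toMul : Kˣ) : K)
  have h2 := HeightOneSpectrum.Support.finite (𝓞 K) ((x.toMul⁻¹ : Kˣ) : K)
  refine (h1.union h2).subset fun v hv => ?_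
  simp only [HeightOneSpectrum.Support, Set.mem_union, Set.mem_ofPred_eq, valuation_eq_exp_ord,
    ← WithZero.exp_zero, WithZero.exp_lt_exp]
  have e1 : ord K v (Additive.ofMul x.toMul) = ord K v x := rfl
  have e2 : ord K v (Additive.ofMul x.toMul⁻¹) = - ord K v x := map_neg (ord K v) x
  rw [e1, e2]
  simp only [Set.mem_ofPred_eq] at hv
  omega

/-- The part prime to `ℓ` of the principal divisor of `x ∈ Kˣ`. -/
def divUnits : Additive Kˣ →+ Divisors ℓ K where
  toFun x := Finsupp.ofSupportFinite (fun v => ((ord K v.1 x : ℤ) : ℤ_[ℓ]))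
    (((ord_finite K x).preimage Subtype.val_injective.injOn).subset fun v hv => by
      simp only [Function.mem_support, ne_eq, Int.cast_eq_zero] at hv
      exact hv)
  map_zero' := by ext v; simp [Finsupp.ofSupportFinite]
  map_add' x y := by
    ext v
    change ((ord K v.1 (x + y) : ℤ) : ℤ_[ℓ]) = (ord K v.1 x : ℤ) + (ord K v.1 y : ℤ)
    rw [map_add, Int.cast_add]

/-- The `ℤ_ℓ`-linear extension `R_K → D'_K` of the divisor map. -/
def divisor : RGlob ℓ K →ₗ[ℤ_[ℓ]] Divisors ℓ K :=
  (divUnits ℓ K).toIntLinearMap.liftBaseChange ℤ_[ℓ]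

/-- The subgroup `P_K^bp` of principal divisors generated by pseudo-infinitesimal elements. -/
def principalDivisors : Submodule ℤ_[ℓ] (Divisors ℓ K) :=
  (pseudoInfinitesimals ℓ K).map (divisor ℓ K)

/-- The group `Cl_K^bp = D'_K / P_K^bp` of pseudo-infinitesimal classes. -/
abbrev BPClassGroup : Type _ := Divisors ℓ K ⧸ principalDivisors ℓ K

end Field

/-! ### Extension of divisors and classes -/

section Extension

variable (ℓ : ℕ) [Fact ℓ.Prime] (K L : Type*) [Field K] [NumberField K] [Field L] [NumberField L]
  [Algebra K L]

/-- The place of `K` below a place of `L`. -/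
abbrev below (w : HeightOneSpectrum (𝓞 L)) : HeightOneSpectrum (𝓞 K) := w.under (𝓞 K)

instance below_liesOver (w : HeightOneSpectrum (𝓞 L)) :
    w.asIdeal.LiesOver (below K L w).asIdeal := ⟨rfl⟩

theorem dividesEll_below (w : HeightOneSpectrum (𝓞 L)) :
    DividesEll ℓ K (below K L w) ↔ DividesEll ℓ L w := by
  change algebraMap (𝓞 K) (𝓞 L) (ℓ : 𝓞 K) ∈ w.asIdeal ↔ _
  rw [map_natCast]
  rfl

/-- The place of `K` below a place of `L` prime to `ℓ`. -/
def belowPrime (w : {w : HeightOneSpectrum (𝓞 L) // ¬ DividesEll ℓ L w}) :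
    {v : HeightOneSpectrum (𝓞 K) // ¬ DividesEll ℓ K v} :=
  ⟨below K L w.1, fun h => w.2 ((dividesEll_below ℓ K L w.1).1 h)⟩

theorem belowPrime_fiber_finite (v : {v : HeightOneSpectrum (𝓞 K) // ¬ DividesEll ℓ K v}) :
    (belowPrime ℓ K L ⁻¹' {v}).Finite := by
  have := v.1.isMaximal
  have h := IsDedekindDomain.primesOver_finite v.1.asIdeal (𝓞 L)
  refine Set.Finite.of_finite_image (f := fun w => w.1.asIdeal) (h.subset ?_) ?_
  · rintro _ ⟨w, hw, rfl⟩
    refine ⟨w.1.isPrime, ⟨?_⟩⟩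
    have : belowPrime ℓ K L w = v := hw
    rw [← this]
    rfl
  · intro w _ w' _ h
    exact Subtype.ext (HeightOneSpectrum.ext h)

/-- The ramification index `e(w|v)`, `v` being the place of `K` below `w`. -/
def ramification (w : HeightOneSpectrum (𝓞 L)) : ℕ :=
  (below K L w).asIdeal.ramificationIdx' w.asIdeal

/-- Extension of divisors `D'_K → D'_L`, sending a prime `v` of `K` to the divisor
`∑_{w ∣ v} e(w|v) w` of the extended ideal `v 𝓞_L`. -/
def divisorExtension : Divisors ℓ K →ₗ[ℤ_[ℓ]] Divisors ℓ L where
  toFun d := Finsupp.ofSupportFinite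
    (fun w => (ramification K L w.1 : ℤ_[ℓ]) * d (belowPrime ℓ K L w))
    ((d.support.finite_toSet.preimage' fun v _ => belowPrime_fiber_finite ℓ K L v).subset
      fun w hw => by
        simp only [Function.mem_support] at hw
        simpa using right_ne_zero_of_mul hw)
  map_add' x y := by ext v; simp [Finsupp.ofSupportFinite, mul_add]
  map_smul' a x := by ext v; simp [Finsupp.ofSupportFinite, mul_left_comm]

/-- The embedding of completions `K_v → L_w`, `v` being the place of `K` below `w`. -/
def completionEmbedding (w : HeightOneSpectrum (𝓞 L)) :
    (below K L w).adicCompletion K →+* w.adicCompletion L :=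
  ((HeightOneSpectrum.adicCompletion.equiv L w).symm.toRingHom.comp
    (UniformSpace.Completion.mapRingHom
      (algebraMap (WithVal ((below K L w).valuation K)) (WithVal (w.valuation L)))
      (HeightOneSpectrum.uniformContinuous_algebraMap_liesOver K L (below K L w) w).continuous)).comp
    (HeightOneSpectrum.adicCompletion.equiv K (below K L w)).toRingHom

theorem completionEmbedding_algebraMap (w : HeightOneSpectrum (𝓞 L)) (x : K) :
    completionEmbedding K L w (algebraMap K ((below K L w).adicCompletion K) x) =
      algebraMap L (w.adicCompletion L) (algebraMap K L x) := by
  apply HeightOneSpectrum.adicCompletion.ext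
  exact UniformSpace.Completion.mapRingHom_coe
    (HeightOneSpectrum.uniformContinuous_algebraMap_liesOver K L (below K L w) w).continuous _

/-- The natural map `R_K → R_L`. -/
def elementExtension : RGlob ℓ K →ₗ[ℤ_[ℓ]] RGlob ℓ L :=
  tensorMap ℓ (Units.map (algebraMap K L : K →* L))

theorem localization_elementExtension (w : HeightOneSpectrum (𝓞 L)) (x : RGlob ℓ K) :
    localization ℓ L w (elementExtension ℓ K L x) =
      completionMap ℓ (Units.map (completionEmbedding K L w : _ →* _))
        (localization ℓ K (below K L w) x) := by
  simp only [localization, elementExtension, LinearMap.comp_apply, completionMap_toCompletion,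
    tensorMap_comp]
  congr 2
  congr 1
  refine MonoidHom.ext fun u => Units.ext ?_
  exact (completionEmbedding_algebraMap K L w u).symm

theorem elementExtension_mem {x : RGlob ℓ K} (hx : x ∈ pseudoInfinitesimals ℓ K) :
    elementExtension ℓ K L x ∈ pseudoInfinitesimals ℓ L := by
  intro w _
  have h := hx ⟨below K L w.1, (dividesEll_below ℓ K L w.1).2 w.2⟩ (Set.mem_univ _)
  change localization ℓ L w.1 _ ∈ _
  rw [localization_elementExtension]
  exact completionMap_mem_torsionImage ℓ _ h

theorem ord_extension (w : HeightOneSpectrum (𝓞 L)) (x : Kˣ) :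
    ord L w (Additive.ofMul (Units.map (algebraMap K L : K →* L) x)) =
      ramification K L w * ord K (below K L w) (Additive.ofMul x) := by
  have h := HeightOneSpectrum.valuation_liesOver L (below K L w) w (x : K)
  have h' := valuation_eq_exp_ord L w (Units.map (algebraMap K L : K →* L) x)
  rw [Units.coe_map, MonoidHom.coe_coe] at h'
  rw [h', valuation_eq_exp_ord, ← WithZero.exp_nsmul, WithZero.exp_inj] at h
  simp only [nsmul_eq_mul, mul_neg, neg_inj] at h
  exact h.symm

theorem divisor_elementExtension (x : RGlob ℓ K) :
    divisor ℓ L (elementExtension ℓ K L x) = divisorExtension ℓ K L (divisor ℓ K x) := by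
  induction x using TensorProduct.induction_on with
  | zero => simp
  | add x y hx hy => simp only [map_add, hx, hy]
  | tmul a u =>
    ext w
    have h := ord_extension K L w.1 u.toMul
    change a * ((ord L w.1 _ : ℤ) : ℤ_[ℓ]) =
      (ramification K L w.1 : ℤ_[ℓ]) * (a * ((ord K (below K L w.1) _ : ℤ) : ℤ_[ℓ]))
    rw [mul_left_comm]
    congr 1
    exact_mod_cast congrArg (Int.cast : ℤ → ℤ_[ℓ]) h

theorem principalDivisors_le :
    principalDivisors ℓ K ≤ (principalDivisors ℓ L).comap (divisorExtension ℓ K L) := by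
  rintro _ ⟨x, hx, rfl⟩
  exact ⟨_, elementExtension_mem ℓ K L hx, divisor_elementExtension ℓ K L x⟩

/-- The extension map `j_{L/K} : Cl_K^bp → Cl_L^bp` induced by extension of divisors. -/
def classExtension : BPClassGroup ℓ K →ₗ[ℤ_[ℓ]] BPClassGroup ℓ L :=
  Submodule.mapQ _ _ (divisorExtension ℓ K L) (principalDivisors_le ℓ K L)

/-- The capitulation subgroup `Cap^bp_{L/K} = ker (Cl_K^bp → Cl_L^bp)`. -/
def capitulation : Submodule ℤ_[ℓ] (BPClassGroup ℓ K) :=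
  LinearMap.ker (classExtension ℓ K L)

end Extension

/-! ### The cyclotomic `ℤ_ℓ`-extension -/

section Cyclotomic

variable (ℓ : ℕ) [Fact ℓ.Prime] (K : Type*) [Field K]

/-- The field `K(μ_{ℓ^∞})` in an algebraic closure of `K`. -/
def cyclotomicTower : IntermediateField K (AlgebraicClosure K) :=
  IntermediateField.adjoin K {ζ : AlgebraicClosure K | ∃ n : ℕ, ζ ^ ℓ ^ n = 1}

/-- `C` is the cyclotomic `ℤ_ℓ`-extension of `K`: the Galois extension of `K` inside
`K(μ_{ℓ^∞})` whose Galois group is topologically isomorphic to `ℤ_ℓ`. -/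
def IsCyclotomicZlExtension (C : IntermediateField K (AlgebraicClosure K)) : Prop :=
  C ≤ cyclotomicTower ℓ K ∧ IsGalois K C ∧ Nonempty (Gal(C/K) ≃ₜ* Multiplicative ℤ_[ℓ])

/-- The finite extension `L` of `K` is a finite layer of the cyclotomic `ℤ_ℓ`-extension of `K`,
that is, it is `K`-isomorphic to a finite subextension of it. -/
def IsCyclotomicLayer (L : Type*) [Field L] [Algebra K L] : Prop :=
  FiniteDimensional K L ∧
    ∃ C : IntermediateField K (AlgebraicClosure K), IsCyclotomicZlExtension ℓ K C ∧
      ∃ φ : L →ₐ[K] AlgebraicClosure K, φ.fieldRange ≤ C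

end Cyclotomic

end PseudoInfinitesimal

end

/-!
Write `R_L = ℤ_ℓ ⊗ Lˣ` additively, and let `T_L` be its torsion, which is the group of roots of unity
of `ℓ`-power order of `L` because `ℤ_ℓ` is flat over `ℤ` (`exists_eq_one_tmul_of_smul_eq_zero`,
`eq_one_of_one_tmul_eq_zero`).

Suppose that the divisor `d` of `K` becomes in `L` the divisor of a pseudo-infinitesimal element `x`.
For `σ ∈ Gal(L/K)` the element `σ x - x` is pseudo-infinitesimal with trivial divisor. Its orders at
the places dividing `ℓ` vanish as well, since it is torsion there; so it comes from `ℤ_ℓ ⊗ E_L`, and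
the Leopoldt conjecture puts it in `T_L` (`mem_torsion_of_divisor_eq_zero`,
`embeddingMap_sub_mem_torsion`). Thus `σ ↦ σ x - x` is a `1`-cocycle with values in `T_L`. If it is a
coboundary, perhaps after enlarging `L`, then `x` is the sum of a torsion element and of an element
`y` of `R_L^G = R_K` (`exists_elementExtension_eq`); and then `d` is the divisor of `y`, which is
pseudo-infinitesimal in `K` (`capitulation_eq_bot`). The last point is local: an element of the
`ℓ`-adic completion of `Fˣ` coming from `ℤ_ℓ ⊗ Fˣ` is in the image of the roots of unity if and only
if it is torsion (`toCompletion_mem_torsionImage`), and norms detect torsion in finite extensions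
(`toCompletion_mem_torsion_of_finiteDimensional`).

If `K` does not contain the `ℓ`-th roots of unity, neither does `L`, since `Gal(L/K)` is an `ℓ`-group;
so `T_L = 0` and there is nothing to prove about the cocycle. If `K` contains them and `L` is a
cyclotomic layer, then `L ⊆ M = K(ζ)` with `ζ` of order `ℓ ^ n`, where `n` can be chosen so large that
the cocycle takes its values in the group generated by `ζ`. The group `Gal(M/K)` is cyclic, generated
by an automorphism `ζ ↦ ζ ^ c` with `c ≡ 1 mod ℓ`, and lifting the exponent shows that its first
cohomology group with values in the group generated by `ζ` vanishes
(`exists_eq_sub_one_mul_of_dvd_mul_geom_sum`, `exists_sub_elementExtension_mem_torsion`).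
-/

set_option linter.unusedSectionVars false

namespace PseudoInfinitesimal

/-! ### Flatness of `ℤ_ℓ` and the torsion of `ℤ_ℓ ⊗ A` -/

section Tensor

variable {ℓ : ℕ} [Fact ℓ.Prime]

theorem mem_torsion_iff_exists_pow {M : Type*} [AddCommGroup M] [Module ℤ_[ℓ] M] {x : M} :
    x ∈ Submodule.torsion ℤ_[ℓ] M ↔ ∃ k : ℕ, (ℓ : ℤ_[ℓ]) ^ k • x = 0 := by
  have hℓ : (ℓ : ℤ_[ℓ]) ≠ 0 := PadicInt.prime_p.ne_zero
  rw [Submodule.mem_torsion_iff]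
  constructor
  · rintro ⟨⟨a, ha⟩, h⟩
    have ha0 : a ≠ 0 := nonZeroDivisors.ne_zero ha
    refine ⟨a.valuation, ?_⟩
    have h' : a • x = 0 := h
    rw [PadicInt.unitCoeff_spec ha0, mul_smul] at h'
    exact (smul_eq_zero_iff_eq (PadicInt.unitCoeff ha0)).1 h'
  · rintro ⟨k, hk⟩
    exact ⟨⟨(ℓ : ℤ_[ℓ]) ^ k, mem_nonZeroDivisors_of_ne_zero (pow_ne_zero _ hℓ)⟩, hk⟩

theorem mem_torsion_of_smul {M : Type*} [AddCommGroup M] [Module ℤ_[ℓ] M] {a : ℤ_[ℓ]}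
    (ha : a ≠ 0) {x : M} (h : a • x ∈ Submodule.torsion ℤ_[ℓ] M) :
    x ∈ Submodule.torsion ℤ_[ℓ] M := by
  obtain ⟨k, hk⟩ := mem_torsion_iff_exists_pow.1 h
  rw [Submodule.mem_torsion_iff]
  refine ⟨⟨(ℓ : ℤ_[ℓ]) ^ k * a, mem_nonZeroDivisors_of_ne_zero
    (mul_ne_zero (pow_ne_zero _ PadicInt.prime_p.ne_zero) ha)⟩, ?_⟩
  change ((ℓ : ℤ_[ℓ]) ^ k * a) • x = 0
  rw [mul_smul, hk]

theorem map_mem_torsion {M N : Type*} [AddCommGroup M] [Module ℤ_[ℓ] M] [AddCommGroup N]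
    [Module ℤ_[ℓ] N] (f : M →ₗ[ℤ_[ℓ]] N) {x : M} (h : x ∈ Submodule.torsion ℤ_[ℓ] M) :
    f x ∈ Submodule.torsion ℤ_[ℓ] N := by
  obtain ⟨k, hk⟩ := mem_torsion_iff_exists_pow.1 h
  exact mem_torsion_iff_exists_pow.2 ⟨k, by rw [← map_smul, hk, map_zero]⟩

theorem mem_torsion_of_map_injective {M N : Type*} [AddCommGroup M] [Module ℤ_[ℓ] M]
    [AddCommGroup N] [Module ℤ_[ℓ] N] {f : M →ₗ[ℤ_[ℓ]] N} (hf : Function.Injective f) {x : M}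
    (h : f x ∈ Submodule.torsion ℤ_[ℓ] N) : x ∈ Submodule.torsion ℤ_[ℓ] M := by
  obtain ⟨k, hk⟩ := mem_torsion_iff_exists_pow.1 h
  refine mem_torsion_iff_exists_pow.2 ⟨k, hf ?_⟩
  rw [map_smul, hk, map_zero]

variable {A B C : Type*} [CommGroup A] [CommGroup B] [CommGroup C]

theorem tensorMap_injective {f : A →* B} (hf : Function.Injective f) :
    Function.Injective (tensorMap ℓ f) :=
  Module.Flat.lTensor_preserves_injective_linearMap (M := ℤ_[ℓ])
    (MonoidHom.toAdditive f).toIntLinearMap hf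

/-- `ℤ_ℓ ⊗ -` is exact. -/
theorem exists_tensorMap_eq (f : A →* B) (g : B →* C) (h : ∀ b, g b = 1 → ∃ a, f a = b)
    (h' : ∀ a, g (f a) = 1) {x : AdicTensor ℓ B} (hx : tensorMap ℓ g x = 0) :
    ∃ y, tensorMap ℓ f y = x := by
  have hex : Function.Exact (MonoidHom.toAdditive f).toIntLinearMap
      (MonoidHom.toAdditive g).toIntLinearMap := fun b =>
    ⟨fun hb => h b hb, by rintro ⟨a, rfl⟩; exact h' a⟩
  exact (Module.Flat.lTensor_exact ℤ_[ℓ] hex x).1 hx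

theorem tensorMap_id (x : AdicTensor ℓ A) : tensorMap ℓ (MonoidHom.id A) x = x := by
  induction x using TensorProduct.induction_on with
  | zero => simp
  | tmul a b => rfl
  | add x y hx hy => simp only [map_add, hx, hy]

theorem tensorMap_pow (n : ℕ) (x : AdicTensor ℓ A) :
    tensorMap ℓ (powMonoidHom n) x = (n : ℤ_[ℓ]) • x := by
  induction x using TensorProduct.induction_on with
  | zero => simp
  | add x y hx hy => simp only [map_add, hx, hy, smul_add]
  | tmul a b =>
    change a ⊗ₜ[ℤ] (n • b) = _
    rw [TensorProduct.tmul_smul, Nat.cast_smul_eq_nsmul]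

/-- If `A` is killed by `ℓ ^ k`, every element of `ℤ_ℓ ⊗ A` comes from `A`, because
`ℤ → ℤ_ℓ / ℓ ^ k` is surjective. -/
theorem exists_eq_one_tmul {k : ℕ} (hA : ∀ a : A, a ^ ℓ ^ k = 1) (x : AdicTensor ℓ A) :
    ∃ a : A, x = (1 : ℤ_[ℓ]) ⊗ₜ[ℤ] Additive.ofMul a := by
  induction x using TensorProduct.induction_on with
  | zero => exact ⟨1, by simp⟩
  | add x y hx hy =>
    obtain ⟨a, rfl⟩ := hx
    obtain ⟨b, rfl⟩ := hy
    exact ⟨a * b, by rw [ofMul_mul, TensorProduct.tmul_add]⟩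
  | tmul z a =>
    obtain ⟨b, hb⟩ := Ideal.mem_span_singleton'.1 (PadicInt.appr_spec k z)
    have hz : z = b * ((ℓ : ℤ_[ℓ]) ^ k) + (z.appr k : ℤ_[ℓ]) := by rw [hb]; ring
    have h0 : (ℓ ^ k) • a = 0 := hA a.toMul
    refine ⟨a.toMul ^ z.appr k, ?_⟩
    have e1 : ((b * ((ℓ : ℤ_[ℓ]) ^ k)) ⊗ₜ[ℤ] a : AdicTensor ℓ A) = 0 := by
      have : b * ((ℓ : ℤ_[ℓ]) ^ k) = (ℓ ^ k) • b := by
        rw [nsmul_eq_mul]; push_cast; ring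
      rw [this, TensorProduct.smul_tmul, h0, TensorProduct.tmul_zero]
    have e2 : ((z.appr k : ℤ_[ℓ]) ⊗ₜ[ℤ] a : AdicTensor ℓ A) =
        (1 : ℤ_[ℓ]) ⊗ₜ[ℤ] (z.appr k • a) := by
      rw [← TensorProduct.smul_tmul, nsmul_eq_mul, mul_one]
    conv_lhs => rw [hz, TensorProduct.add_tmul, e1, zero_add, e2]
    rfl

/-- The torsion of `ℤ_ℓ ⊗ A` comes from the `ℓ`-power torsion of `A`. -/
theorem exists_eq_one_tmul_of_smul_eq_zero {k : ℕ} {x : AdicTensor ℓ A}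
    (hx : (ℓ : ℤ_[ℓ]) ^ k • x = 0) :
    ∃ ζ : A, ζ ^ ℓ ^ k = 1 ∧ x = (1 : ℤ_[ℓ]) ⊗ₜ[ℤ] Additive.ofMul ζ := by
  let g : A →* A := powMonoidHom (ℓ ^ k)
  have hx' : tensorMap ℓ g x = 0 := by
    rw [tensorMap_pow]
    exact_mod_cast hx
  obtain ⟨y, rfl⟩ := exists_tensorMap_eq g.ker.subtype g (fun b hb => ⟨⟨b, hb⟩, rfl⟩)
    (fun a => a.2) hx'
  obtain ⟨a, rfl⟩ := exists_eq_one_tmul (k := k) (fun a => Subtype.ext a.2) y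
  exact ⟨a, a.2, rfl⟩

theorem one_tmul_mem_torsion {k : ℕ} {ζ : A} (h : ζ ^ ℓ ^ k = 1) :
    ((1 : ℤ_[ℓ]) ⊗ₜ[ℤ] Additive.ofMul ζ : AdicTensor ℓ A) ∈
      Submodule.torsion ℤ_[ℓ] (AdicTensor ℓ A) := by
  refine mem_torsion_iff_exists_pow.2 ⟨k, ?_⟩
  have := tensorMap_pow (ℓ := ℓ) (ℓ ^ k) ((1 : ℤ_[ℓ]) ⊗ₜ[ℤ] Additive.ofMul ζ)
  rw [Nat.cast_pow] at this
  rw [← this]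
  change (1 : ℤ_[ℓ]) ⊗ₜ[ℤ] Additive.ofMul (ζ ^ ℓ ^ k) = 0
  rw [h, ofMul_one, TensorProduct.tmul_zero]

/-- The `ℓ`-power torsion of `A` embeds in `ℤ_ℓ ⊗ A`: by flatness `A` may be replaced by
`A[ℓ ^ k]`, on which `ℤ_ℓ` acts through `ℤ / ℓ ^ k`. -/
theorem eq_one_of_one_tmul_eq_zero {k : ℕ} {ζ : A} (h : ζ ^ ℓ ^ k = 1)
    (h0 : ((1 : ℤ_[ℓ]) ⊗ₜ[ℤ] Additive.ofMul ζ : AdicTensor ℓ A) = 0) : ζ = 1 := by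
  let g : A →* A := powMonoidHom (ℓ ^ k)
  have h1 : ((1 : ℤ_[ℓ]) ⊗ₜ[ℤ] Additive.ofMul (⟨ζ, h⟩ : g.ker) : AdicTensor ℓ g.ker) = 0 :=
    tensorMap_injective (f := g.ker.subtype) Subtype.val_injective h0
  let _ : Module (ZMod (ℓ ^ k)) (Additive g.ker) :=
    AddCommGroup.zmodModule fun x => Subtype.ext x.toMul.2
  let φ : ℤ_[ℓ] →+ Additive g.ker →+ Additive g.ker :=
    (smulAddHom (ZMod (ℓ ^ k)) (Additive g.ker)).comp
      (PadicInt.toZModPow k : ℤ_[ℓ] →+* ZMod (ℓ ^ k)).toAddMonoidHom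
  have hφ : ∀ (r : ℤ) (m : ℤ_[ℓ]) (n : Additive g.ker), φ (r • m) n = φ m (r • n) := by
    intro r m n
    rw [map_zsmul, map_zsmul, AddMonoidHom.zsmul_apply]
  have h2 := congrArg (TensorProduct.liftAddHom φ hφ) h1
  rw [TensorProduct.liftAddHom_tmul, map_zero] at h2
  have h3 : φ 1 (Additive.ofMul (⟨ζ, h⟩ : g.ker)) = Additive.ofMul (⟨ζ, h⟩ : g.ker) := by
    change (PadicInt.toZModPow k (1 : ℤ_[ℓ])) • (Additive.ofMul (⟨ζ, h⟩ : g.ker)) = _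
    rw [map_one, one_smul]
  rw [h3] at h2
  exact congrArg Subtype.val (congrArg Additive.toMul h2)

/-- `ℤ_ℓ ⊗ -` commutes with the formation of the invariants of a finite set of endomorphisms. -/
theorem exists_tensorMap_eq_of_invariant {ι : Type*} [Finite ι] (σ : ι → B →* B) (f : A →* B)
    (h : ∀ b, (∀ i, σ i b = b) → ∃ a, f a = b) (h' : ∀ a i, σ i (f a) = f a)
    {x : AdicTensor ℓ B} (hx : ∀ i, tensorMap ℓ (σ i) x = x) : ∃ y, tensorMap ℓ f y = x := by
  classical
  have := Fintype.ofFinite ι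
  let g : B →* (ι → B) := MonoidHom.pi fun i => σ i / MonoidHom.id B
  refine exists_tensorMap_eq f g (fun b hb => h b fun i => ?_) (fun a => ?_) ?_
  · exact div_eq_one.1 (congrFun hb i)
  · funext i
    exact div_eq_one.2 (h' a i)
  · let e : AdicTensor ℓ (ι → B) ≃ₗ[ℤ_[ℓ]] (ι → AdicTensor ℓ B) :=
      TensorProduct.piRight ℤ ℤ_[ℓ] ℤ_[ℓ] (fun _ : ι => Additive B)
    have key : ∀ y i, e (tensorMap ℓ g y) i = tensorMap ℓ (σ i) y - y := by
      intro y i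
      induction y using TensorProduct.induction_on with
      | zero => simp
      | add y z hy hz => simp only [map_add, Pi.add_apply, hy, hz]; abel
      | tmul a b =>
        change a ⊗ₜ[ℤ] (Additive.ofMul (σ i b.toMul / b.toMul)) = _
        rw [ofMul_div, TensorProduct.tmul_sub]
        rfl
    refine e.injective ?_
    rw [map_zero]
    funext i
    rw [key, hx, sub_self, Pi.zero_apply]

end Tensor

/-! ### Torsion in the `ℓ`-adic completion of the multiplicative group of a field -/

section Completion

variable {ℓ : ℕ} [Fact ℓ.Prime]

theorem toCompletion_eq_zero_iff {A : Type*} [CommGroup A] {t : AdicTensor ℓ A} :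
    toCompletion ℓ A t = 0 ↔ ∀ n : ℕ, ∃ s : AdicTensor ℓ A, t = (ℓ : ℤ_[ℓ]) ^ n • s := by
  have key : ∀ n : ℕ, t ∈ (Ideal.span {(ℓ : ℤ_[ℓ])} ^ n • ⊤ : Submodule ℤ_[ℓ] (AdicTensor ℓ A)) ↔
      ∃ s : AdicTensor ℓ A, t = (ℓ : ℤ_[ℓ]) ^ n • s := by
    intro n
    rw [Ideal.span_singleton_pow, Submodule.ideal_span_singleton_smul,
      Submodule.mem_smul_pointwise_iff_exists]
    simp [eq_comm]
  constructor
  · intro h n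
    have := congrArg (AdicCompletion.eval _ _ n) h
    rw [toCompletion, AdicCompletion.eval_of, map_zero, Submodule.mkQ_apply,
      Submodule.Quotient.mk_eq_zero] at this
    exact (key n).1 this
  · intro h
    refine AdicCompletion.ext fun n => ?_
    rw [toCompletion, AdicCompletion.of_apply, AdicCompletion.val_zero_apply, Submodule.mkQ_apply,
      Submodule.Quotient.mk_eq_zero]
    exact (key n).2 (h n)

theorem torsionImage_le_torsion (A : Type*) [CommGroup A] :
    torsionImage ℓ A ≤ Submodule.torsion ℤ_[ℓ] (AdicGroupCompletion ℓ A) := by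
  refine Submodule.span_le.2 ?_
  rintro _ ⟨ζ, ⟨n, hn⟩, rfl⟩
  exact map_mem_torsion _ (one_tmul_mem_torsion hn)

/-- For a field `F`, a torsion element of `lim Fˣ / (Fˣ)^(ℓ^n)` coming from `ℤ_ℓ ⊗ Fˣ` comes from
a root of unity: modulo `ℓ ^ n` it agrees with some element of the finite group `μ_{ℓ^k}(F)`, and
one and the same element works for infinitely many `n`. -/
theorem toCompletion_mem_torsionImage {F : Type*} [Field F] {t : AdicTensor ℓ Fˣ}
    (h : toCompletion ℓ Fˣ t ∈ Submodule.torsion ℤ_[ℓ] (AdicGroupCompletion ℓ Fˣ)) :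
    toCompletion ℓ Fˣ t ∈ torsionImage ℓ Fˣ := by
  obtain ⟨k, hk⟩ := mem_torsion_iff_exists_pow.1 h
  rw [← map_smul, toCompletion_eq_zero_iff] at hk
  have step : ∀ n : ℕ, ∃ ζ : rootsOfUnity (ℓ ^ k) F, ∃ s : AdicTensor ℓ Fˣ,
      t - (1 : ℤ_[ℓ]) ⊗ₜ[ℤ] Additive.ofMul (ζ : Fˣ) = (ℓ : ℤ_[ℓ]) ^ n • s := by
    intro n
    obtain ⟨s, hs⟩ := hk (n + k)
    have h0 : (ℓ : ℤ_[ℓ]) ^ k • (t - (ℓ : ℤ_[ℓ]) ^ n • s) = 0 := by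
      rw [smul_sub, hs, smul_smul, ← pow_add, add_comm k n, sub_self]
    obtain ⟨ζ, hζ, e⟩ := exists_eq_one_tmul_of_smul_eq_zero h0
    exact ⟨⟨ζ, hζ⟩, s, by rw [← e]; abel⟩
  choose ζ hζ using step
  have : NeZero (ℓ ^ k) := ⟨pow_ne_zero _ (Fact.out : ℓ.Prime).ne_zero⟩
  obtain ⟨ξ, hξ⟩ := Finite.exists_infinite_fiber ζ
  have hinf : (ζ ⁻¹' {ξ}).Infinite := Set.infinite_coe_iff.1 hξ
  have h0 : toCompletion ℓ Fˣ (t - (1 : ℤ_[ℓ]) ⊗ₜ[ℤ] Additive.ofMul (ξ : Fˣ)) = 0 := by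
    rw [toCompletion_eq_zero_iff]
    intro n
    obtain ⟨m, hm, hnm⟩ := hinf.exists_gt n
    obtain ⟨s, hs⟩ := hζ m
    rw [show ζ m = ξ from hm] at hs
    refine ⟨(ℓ : ℤ_[ℓ]) ^ (m - n) • s, ?_⟩
    rw [hs, smul_smul, ← pow_add, Nat.add_sub_cancel' hnm.le]
  rw [map_sub, sub_eq_zero] at h0
  rw [h0]
  exact Submodule.subset_span ⟨ξ, ⟨k, ξ.2⟩, rfl⟩

/-- Torsion can be tested after a finite extension of fields, by taking norms. -/
theorem toCompletion_mem_torsion_of_finiteDimensional {F E : Type*} [Field F] [Field E]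
    [Algebra F E] [FiniteDimensional F E] {t : AdicTensor ℓ Fˣ}
    (h : toCompletion ℓ Eˣ (tensorMap ℓ (Units.map (algebraMap F E : F →* E)) t) ∈
      Submodule.torsion ℤ_[ℓ] (AdicGroupCompletion ℓ Eˣ)) :
    toCompletion ℓ Fˣ t ∈ Submodule.torsion ℤ_[ℓ] (AdicGroupCompletion ℓ Fˣ) := by
  have h1 := map_mem_torsion (completionMap ℓ (Units.map (Algebra.norm F : E →* F))) h
  rw [completionMap_toCompletion, tensorMap_comp] at h1
  have h2 : (Units.map (Algebra.norm F : E →* F)).comp (Units.map (algebraMap F E : F →* E)) =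
      powMonoidHom (Module.finrank F E) :=
    MonoidHom.ext fun u => Units.ext (Algebra.norm_algebraMap (S := E) (u : F))
  rw [h2, tensorMap_pow, map_smul] at h1
  exact mem_torsion_of_smul (Nat.cast_ne_zero.2 Module.finrank_pos.ne') h1

end Completion

/-! ### Pseudo-infinitesimal elements in extensions -/

section PseudoInf

variable {ℓ : ℕ} [Fact ℓ.Prime] {K : Type*} [Field K] [NumberField K]

/-- An element of `R_K` is pseudo-infinitesimal if and only if it is a torsion element at all
places dividing `ℓ`. -/
theorem mem_pseudoInfinitesimals_iff {x : RGlob ℓ K} :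
    x ∈ pseudoInfinitesimals ℓ K ↔ ∀ v : HeightOneSpectrum (𝓞 K), DividesEll ℓ K v →
      localization ℓ K v x ∈ Submodule.torsion ℤ_[ℓ] (RLoc ℓ K v) :=
  ⟨fun h v hv => torsionImage_le_torsion _ (h ⟨v, hv⟩ (Set.mem_univ _)),
    fun h v _ => toCompletion_mem_torsionImage (h v.1 v.2)⟩

theorem torsion_le_pseudoInfinitesimals :
    Submodule.torsion ℤ_[ℓ] (RGlob ℓ K) ≤ pseudoInfinitesimals ℓ K := fun _ hx =>
  mem_pseudoInfinitesimals_iff.2 fun _ _ => map_mem_torsion _ hx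

variable (K) in
theorem below_surjective (L : Type*) [Field L] [NumberField L] [Algebra K L] :
    Function.Surjective (below K L) := by
  intro v
  obtain ⟨P, hP, hover⟩ := Ideal.exists_maximal_ideal_liesOver_of_isIntegral (S := 𝓞 L) v.asIdeal
  refine ⟨⟨P, hP.isPrime, ?_⟩, HeightOneSpectrum.ext hover.over.symm⟩
  exact Ideal.ne_bot_of_liesOver_of_ne_bot v.ne_bot P

variable {L : Type*} [Field L] [NumberField L] [Algebra K L]

open HeightOneSpectrum in
theorem continuous_completionEmbedding (w : HeightOneSpectrum (𝓞 L)) :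
    Continuous (completionEmbedding K L w) :=
  (adicCompletion.continuous_ofCompletion L w).comp
    (UniformSpace.Completion.continuous_map.comp (adicCompletion.continuous_toCompletion K _))

/-- An element of `R_K` which becomes pseudo-infinitesimal in `R_L` is pseudo-infinitesimal: the
extensions of completions are finite, so that being torsion at `v` can be tested above `v`. -/
theorem mem_pseudoInfinitesimals_of_elementExtension {y : RGlob ℓ K}
    (h : elementExtension ℓ K L y ∈ pseudoInfinitesimals ℓ L) : y ∈ pseudoInfinitesimals ℓ K := by
  rw [mem_pseudoInfinitesimals_iff] at h ⊢
  intro v hv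
  obtain ⟨w, rfl⟩ := below_surjective K L v
  have h1 := h w ((dividesEll_below ℓ K L w).1 hv)
  rw [localization_elementExtension, localization, LinearMap.comp_apply,
    completionMap_toCompletion] at h1
  let _ : Algebra ((below K L w).adicCompletion K) (w.adicCompletion L) :=
    (completionEmbedding K L w).toAlgebra
  have : ContinuousSMul ((below K L w).adicCompletion K) (w.adicCompletion L) :=
    ⟨((continuous_completionEmbedding w).comp continuous_fst).mul continuous_snd⟩
  have : IsScalarTower K ((below K L w).adicCompletion K) (w.adicCompletion L) :=
    IsScalarTower.of_algebraMap_eq fun x => by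
      rw [RingHom.algebraMap_toAlgebra, completionEmbedding_algebraMap]
      exact IsScalarTower.algebraMap_apply K L (w.adicCompletion L) x
  have : Module.Finite ((below K L w).adicCompletion K) (w.adicCompletion L) := inferInstance
  exact toCompletion_mem_torsion_of_finiteDimensional h1

end PseudoInf

/-! ### Orders of elements of `R_K` and the kernel of the divisor map -/

section Order

variable {ℓ : ℕ} [Fact ℓ.Prime]

/-- The `ℤ_ℓ`-linear extension of a homomorphism `A → ℤ`. -/
noncomputable def adicExtend (ℓ : ℕ) [Fact ℓ.Prime] {A : Type*} [CommGroup A]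
    (f : Additive A →+ ℤ) : AdicTensor ℓ A →ₗ[ℤ_[ℓ]] ℤ_[ℓ] :=
  ((Int.castAddHom ℤ_[ℓ]).comp f).toIntLinearMap.liftBaseChange ℤ_[ℓ]

theorem adicExtend_tmul {A : Type*} [CommGroup A] (f : Additive A →+ ℤ) (a : ℤ_[ℓ])
    (u : Additive A) : adicExtend ℓ f (a ⊗ₜ u) = a * (f u : ℤ_[ℓ]) := rfl

theorem adicExtend_tensorMap {A B : Type*} [CommGroup A] [CommGroup B] (f : Additive B →+ ℤ)
    (g : A →* B) (x : AdicTensor ℓ A) :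
    adicExtend ℓ f (tensorMap ℓ g x) = adicExtend ℓ (f.comp (MonoidHom.toAdditive g)) x := by
  induction x using TensorProduct.induction_on with
  | zero => simp
  | tmul a b => rfl
  | add x y hx hy => simp only [map_add, hx, hy]

/-- A homomorphism to `ℤ_ℓ` kills the elements that are torsion in the completion, as `ℤ_ℓ` is
`ℓ`-adically separated and torsion-free. -/
theorem eq_zero_of_toCompletion_mem_torsion {A : Type*} [CommGroup A]
    (φ : AdicTensor ℓ A →ₗ[ℤ_[ℓ]] ℤ_[ℓ]) {t : AdicTensor ℓ A}
    (h : toCompletion ℓ A t ∈ Submodule.torsion ℤ_[ℓ] (AdicGroupCompletion ℓ A)) : φ t = 0 := by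
  obtain ⟨k, hk⟩ := mem_torsion_iff_exists_pow.1 h
  rw [← map_smul, toCompletion_eq_zero_iff] at hk
  have h0 : (ℓ : ℤ_[ℓ]) ^ k * φ t = 0 := by
    by_contra hne
    obtain ⟨s, hs⟩ := hk (((ℓ : ℤ_[ℓ]) ^ k * φ t).valuation + 1)
    have hs' := congrArg φ hs
    rw [map_smul, map_smul, smul_eq_mul, smul_eq_mul] at hs'
    have := (PadicInt.mem_span_pow_iff_le_valuation _ hne _).1
      (Ideal.mem_span_singleton.2 (Dvd.intro _ hs'.symm))
    omega
  exact (mul_eq_zero.1 h0).resolve_left (pow_ne_zero _ PadicInt.prime_p.ne_zero)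

variable (K : Type*) [Field K] [NumberField K]

/-- The normalized order `K_vˣ → ℤ` of the completion of `K` at `v`. -/
noncomputable def localOrd (v : HeightOneSpectrum (𝓞 K)) :
    Additive (v.adicCompletion K)ˣ →+ ℤ where
  toFun u := -(WithZero.log (Valued.v (u.toMul : v.adicCompletion K)))
  map_zero' := by simp
  map_add' x y := by
    rw [toMul_add, Units.val_mul, map_mul, WithZero.log_mul, neg_add]
    · simp
    · simp

theorem localOrd_comp (v : HeightOneSpectrum (𝓞 K)) :
    (localOrd K v).comp (MonoidHom.toAdditive (unitsEmbedding K v)) = ord K v := by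
  refine AddMonoidHom.ext fun u => ?_
  change -(WithZero.log (Valued.v (algebraMap K (v.adicCompletion K) (u.toMul : Kˣ)))) = _
  have h := HeightOneSpectrum.valuedAdicCompletion_eq_valuation' v (u.toMul : K)
  rw [HeightOneSpectrum.algebraMap_adicCompletion]
  change -(WithZero.log (Valued.v ((u.toMul : K) : v.adicCompletion K))) = _
  rw [h, valuation_eq_exp_ord, WithZero.log_exp, neg_neg]
  rfl

variable {K}

theorem adicExtend_ord_eq_zero {v : HeightOneSpectrum (𝓞 K)} {x : RGlob ℓ K}
    (h : localization ℓ K v x ∈ Submodule.torsion ℤ_[ℓ] (RLoc ℓ K v)) :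
    adicExtend ℓ (ord K v) x = 0 := by
  rw [← localOrd_comp, ← adicExtend_tensorMap]
  exact eq_zero_of_toCompletion_mem_torsion _ h

theorem divisor_apply (x : RGlob ℓ K) (v : {v : HeightOneSpectrum (𝓞 K) // ¬ DividesEll ℓ K v}) :
    divisor ℓ K x v = adicExtend ℓ (ord K v.1) x := by
  induction x using TensorProduct.induction_on with
  | zero => simp
  | tmul a b => rfl
  | add x y hx hy => simp only [map_add, Finsupp.add_apply, hx, hy]

theorem exists_unit_of_ord_eq_zero {x : Kˣ} (h : ∀ v, ord K v (Additive.ofMul x) = 0) :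
    ∃ u : (𝓞 K)ˣ, Units.map (algebraMap (𝓞 K) K : 𝓞 K →* K) u = x := by
  have h1 : ∀ v : HeightOneSpectrum (𝓞 K), v.valuation K (x : K) = 1 := fun v => by
    rw [valuation_eq_exp_ord, h, neg_zero, WithZero.exp_zero]
  obtain ⟨a, ha⟩ := HeightOneSpectrum.mem_integers_of_valuation_le_one K (x : K)
    fun v => (h1 v).le
  obtain ⟨b, hb⟩ := HeightOneSpectrum.mem_integers_of_valuation_le_one (R := 𝓞 K) K
    ((x⁻¹ : Kˣ) : K) fun v => by
      rw [Units.val_inv_eq_inv_val, map_inv₀, h1 v, inv_one]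
  have hab : a * b = 1 := FaithfulSMul.algebraMap_injective (𝓞 K) K (by
    rw [map_mul, ha, hb, map_one, Units.mul_inv])
  exact ⟨⟨a, b, hab, by rw [mul_comm, hab]⟩, Units.ext ha⟩

/-- The elements of `R_K` whose orders all vanish come from `ℤ_ℓ ⊗ E_K`. -/
theorem exists_units_of_adicExtend_ord_eq_zero {x : RGlob ℓ K}
    (h : ∀ v, adicExtend ℓ (ord K v) x = 0) :
    ∃ u : AdicTensor ℓ (𝓞 K)ˣ,
      tensorMap ℓ (Units.map (algebraMap (𝓞 K) K : 𝓞 K →* K)) u = x := by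
  classical
  let D : Additive Kˣ →+ (HeightOneSpectrum (𝓞 K) →₀ ℤ) :=
    { toFun := fun x => Finsupp.ofSupportFinite (fun v => ord K v x) (ord_finite K x)
      map_zero' := by ext v; simp [Finsupp.ofSupportFinite]
      map_add' := fun x y => by
        ext v
        exact map_add (ord K v) x y }
  let i : Additive (𝓞 K)ˣ →ₗ[ℤ] Additive Kˣ := (MonoidHom.toAdditive
    (Units.map (algebraMap (𝓞 K) K : 𝓞 K →* K))).toIntLinearMap
  have hex : Function.Exact i D.toIntLinearMap := by
    intro y
    constructor
    · intro hy
      obtain ⟨u, hu⟩ := exists_unit_of_ord_eq_zero (x := y.toMul) fun v => DFunLike.congr_fun hy v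
      exact ⟨Additive.ofMul u, hu⟩
    · rintro ⟨u, rfl⟩
      ext v
      change -(Multiplicative.toAdd (v.valuationOfNeZero
        (Units.map (algebraMap (𝓞 K) K : 𝓞 K →* K) u.toMul))) = 0
      rw [HeightOneSpectrum.valuation_of_unit_eq, toAdd_one, neg_zero]
  refine (Module.Flat.lTensor_exact ℤ_[ℓ] hex x).1 ?_
  refine (TensorProduct.finsuppScalarRight ℤ ℤ ℤ_[ℓ] (HeightOneSpectrum (𝓞 K))).injective ?_
  rw [map_zero]
  ext v
  rw [Finsupp.zero_apply, ← h v]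
  clear h
  induction x using TensorProduct.induction_on with
  | zero => simp
  | tmul a b =>
    rw [LinearMap.lTensor_tmul, TensorProduct.finsuppScalarRight_apply_tmul_apply, adicExtend_tmul,
      zsmul_eq_mul, mul_comm]
    rfl
  | add x y hx hy => simp only [map_add, Finsupp.add_apply, hx, hy]

variable (K) in
theorem finite_dividesEll : {v : HeightOneSpectrum (𝓞 K) | DividesEll ℓ K v}.Finite := by
  have hne : Ideal.span {(ℓ : 𝓞 K)} ≠ 0 := by
    rw [Ne, Ideal.zero_eq_bot, Ideal.span_singleton_eq_bot]
    exact Nat.cast_ne_zero.2 (Fact.out : ℓ.Prime).ne_zero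
  refine (Ideal.finite_factors hne).subset fun v hv => ?_
  exact (Ideal.dvd_span_singleton).2 hv

/-- Under the Leopoldt conjecture, a pseudo-infinitesimal element with trivial divisor is a
torsion element: its orders at the places dividing `ℓ` vanish too, so that it comes from
`ℤ_ℓ ⊗ E_K`, where the Leopoldt conjecture applies to a multiple of it. -/
theorem mem_torsion_of_divisor_eq_zero (hL : LeopoldtConjecture ℓ K) {x : RGlob ℓ K}
    (hx : x ∈ pseudoInfinitesimals ℓ K) (hd : divisor ℓ K x = 0) :
    x ∈ Submodule.torsion ℤ_[ℓ] (RGlob ℓ K) := by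
  rw [mem_pseudoInfinitesimals_iff] at hx
  obtain ⟨u, rfl⟩ := exists_units_of_adicExtend_ord_eq_zero (x := x) fun v => by
    by_cases hv : DividesEll ℓ K v
    · exact adicExtend_ord_eq_zero (hx v hv)
    · rw [← divisor_apply x ⟨v, hv⟩, hd, Finsupp.zero_apply]
  refine map_mem_torsion _ ?_
  have h1 : ∀ v : {v : HeightOneSpectrum (𝓞 K) // DividesEll ℓ K v}, ∃ k : ℕ,
      (ℓ : ℤ_[ℓ]) ^ k • localization ℓ K v.1
        (tensorMap ℓ (Units.map (algebraMap (𝓞 K) K : 𝓞 K →* K)) u) = 0 :=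
    fun v => mem_torsion_iff_exists_pow.1 (hx v.1 v.2)
  choose k hk using h1
  have : Finite {v : HeightOneSpectrum (𝓞 K) // DividesEll ℓ K v} := finite_dividesEll K
  obtain ⟨N, hN⟩ := (Set.finite_range k).bddAbove
  refine mem_torsion_iff_exists_pow.2 ⟨N, hL ?_⟩
  rw [map_zero, map_smul]
  funext v
  have hv : k v ≤ N := hN ⟨v, rfl⟩
  change (ℓ : ℤ_[ℓ]) ^ N • localization ℓ K v.1 _ = 0
  rw [← Nat.sub_add_cancel hv, pow_add, mul_smul, hk, smul_zero]

end Order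

/-! ### Transitivity of the extension of divisors -/

section Tower

variable {ℓ : ℕ} [Fact ℓ.Prime] {K L M : Type*} [Field K] [NumberField K] [Field L]
  [NumberField L] [Field M] [NumberField M] [Algebra K L] [Algebra L M] [Algebra K M]
  [IsScalarTower K L M]

variable (K L) in
theorem below_below (w : HeightOneSpectrum (𝓞 M)) :
    below K L (below L M w) = below K M w := by
  have : IsScalarTower (𝓞 K) (𝓞 L) (𝓞 M) := inferInstance
  exact HeightOneSpectrum.ext (Ideal.under_under (A := 𝓞 K) (B := 𝓞 L) w.asIdeal)

/-- Multiplicativity of ramification indices. -/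
theorem ramification_mul (w : HeightOneSpectrum (𝓞 M)) :
    ramification K M w = ramification L M w * ramification K L (below L M w) := by
  obtain ⟨π, hπ⟩ := (below K M w).valuation_exists_uniformizer K
  have hπ0 : π ≠ 0 := by
    rintro rfl
    rw [map_zero] at hπ
    exact WithZero.exp_ne_zero hπ.symm
  have h1 := ord_extension K M w (Units.mk0 π hπ0)
  have h2 := ord_extension L M w (Units.map (algebraMap K L : K →* L) (Units.mk0 π hπ0))
  have h3 := ord_extension K L (below L M w) (Units.mk0 π hπ0)
  have e : Units.map (algebraMap L M : L →* M) (Units.map (algebraMap K L : K →* L)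
      (Units.mk0 π hπ0)) = Units.map (algebraMap K M : K →* M) (Units.mk0 π hπ0) :=
    Units.ext (IsScalarTower.algebraMap_apply K L M π).symm
  rw [e, h1, h3, below_below] at h2
  have h4 : ord K (below K M w) (Additive.ofMul (Units.mk0 π hπ0)) ≠ 0 := by
    intro h0
    have := valuation_eq_exp_ord K (below K M w) (Units.mk0 π hπ0)
    rw [h0, Units.val_mk0, hπ, WithZero.exp_inj] at this
    omega
  rw [← mul_assoc] at h2
  exact_mod_cast mul_right_cancel₀ h4 h2

theorem divisorExtension_apply (d : Divisors ℓ K)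
    (w : {w : HeightOneSpectrum (𝓞 L) // ¬ DividesEll ℓ L w}) :
    divisorExtension ℓ K L d w = (ramification K L w.1 : ℤ_[ℓ]) * d (belowPrime ℓ K L w) := rfl

theorem divisorExtension_divisorExtension (d : Divisors ℓ K) :
    divisorExtension ℓ L M (divisorExtension ℓ K L d) = divisorExtension ℓ K M d := by
  ext w
  have h : belowPrime ℓ K L (belowPrime ℓ L M w) = belowPrime ℓ K M w :=
    Subtype.ext (below_below K L w.1)
  rw [divisorExtension_apply, divisorExtension_apply, divisorExtension_apply, h,
    ramification_mul (K := K) (L := L) (M := M), Nat.cast_mul, mul_assoc]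
  rfl

theorem divisorExtension_injective : Function.Injective (divisorExtension ℓ K L) := by
  rw [injective_iff_map_eq_zero]
  intro d hd
  ext v
  obtain ⟨w, hw⟩ := below_surjective K L v.1
  have hw' : ¬ DividesEll ℓ L w := fun h =>
    v.2 (hw ▸ (dividesEll_below ℓ K L w).2 h)
  have hv : belowPrime ℓ K L ⟨w, hw'⟩ = v := Subtype.ext hw
  have h := DFunLike.congr_fun hd ⟨w, hw'⟩
  rw [divisorExtension_apply, hv] at h
  refine (mul_eq_zero.1 h).resolve_left (Nat.cast_ne_zero.2 ?_)
  exact Ideal.IsDedekindDomain.ramificationIdx'_ne_zero_of_liesOver w.asIdeal (below K L w).ne_bot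

end Tower

/-! ### Capitulation and invariants modulo torsion -/

section Capitulation

variable {ℓ : ℕ} [Fact ℓ.Prime] {K L M : Type*} [Field K] [NumberField K] [Field L]
  [NumberField L] [Field M] [NumberField M] [Algebra K L] [Algebra K M]

/-- The map `R_L → R_M` induced by an embedding `L → M` over `K`. -/
noncomputable def embeddingMap (ℓ : ℕ) [Fact ℓ.Prime] (f : L →ₐ[K] M) :
    RGlob ℓ L →ₗ[ℤ_[ℓ]] RGlob ℓ M :=
  tensorMap ℓ (Units.map (f : L →* M))

theorem embeddingMap_injective (f : L →ₐ[K] M) : Function.Injective (embeddingMap ℓ f) :=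
  tensorMap_injective (Units.map_injective f.injective)

theorem embeddingMap_elementExtension (f : L →ₐ[K] M) (y : RGlob ℓ K) :
    embeddingMap ℓ f (elementExtension ℓ K L y) = elementExtension ℓ K M y := by
  rw [embeddingMap, elementExtension, tensorMap_comp, elementExtension]
  congr 1
  congr 1
  exact MonoidHom.ext fun u => Units.ext (f.commutes (u : K))

/-- Any `K`-embedding `L → M` sends a pseudo-infinitesimal element with divisor `d`, where `d`
comes from `K`, to one with the same divisor `d`. -/
theorem embeddingMap_mem_and_divisor (f : L →ₐ[K] M) {x : RGlob ℓ L}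
    (hx : x ∈ pseudoInfinitesimals ℓ L) {d : Divisors ℓ K}
    (hd : divisor ℓ L x = divisorExtension ℓ K L d) :
    embeddingMap ℓ f x ∈ pseudoInfinitesimals ℓ M ∧
      divisor ℓ M (embeddingMap ℓ f x) = divisorExtension ℓ K M d := by
  let _ : Algebra L M := f.toRingHom.toAlgebra
  have : IsScalarTower K L M := IsScalarTower.of_algebraMap_eq fun a => (f.commutes a).symm
  have e : embeddingMap ℓ f x = elementExtension ℓ L M x := rfl
  rw [e, divisor_elementExtension, hd, divisorExtension_divisorExtension]
  exact ⟨elementExtension_mem ℓ L M hx, rfl⟩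

/-- The images in `R_M` of a pseudo-infinitesimal element whose divisor comes from `K`, under two
embeddings of `L` over `K`, differ by a torsion element. -/
theorem embeddingMap_sub_mem_torsion (hL : LeopoldtConjecture ℓ M) (f g : L →ₐ[K] M)
    {x : RGlob ℓ L} (hx : x ∈ pseudoInfinitesimals ℓ L) {d : Divisors ℓ K}
    (hd : divisor ℓ L x = divisorExtension ℓ K L d) :
    embeddingMap ℓ f x - embeddingMap ℓ g x ∈ Submodule.torsion ℤ_[ℓ] (RGlob ℓ M) := by
  obtain ⟨h1, h2⟩ := embeddingMap_mem_and_divisor f hx hd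
  obtain ⟨h3, h4⟩ := embeddingMap_mem_and_divisor g hx hd
  exact mem_torsion_of_divisor_eq_zero hL (Submodule.sub_mem _ h1 h3) (by
    rw [map_sub, h2, h4, sub_self])

/-- Capitulation is trivial as soon as the pseudo-infinitesimal elements of `R_L` whose divisors
come from `K` come themselves from `R_K`, up to torsion. -/
theorem capitulation_eq_bot
    (h : ∀ x ∈ pseudoInfinitesimals ℓ L, ∀ d : Divisors ℓ K,
      divisor ℓ L x = divisorExtension ℓ K L d →
      ∃ y : RGlob ℓ K, x - elementExtension ℓ K L y ∈ Submodule.torsion ℤ_[ℓ] (RGlob ℓ L)) :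
    capitulation ℓ K L = ⊥ := by
  rw [eq_bot_iff]
  intro c hc
  obtain ⟨d, rfl⟩ := Submodule.Quotient.mk_surjective _ c
  obtain ⟨x, hx, hd⟩ : divisorExtension ℓ K L d ∈ principalDivisors ℓ L :=
    (Submodule.Quotient.mk_eq_zero _).1 hc
  obtain ⟨y, hy⟩ := h x hx d hd
  have hy' : elementExtension ℓ K L y ∈ pseudoInfinitesimals ℓ L := by
    have := Submodule.sub_mem _ hx (torsion_le_pseudoInfinitesimals hy)
    rwa [sub_sub_cancel] at this
  have h0 : divisor ℓ L (x - elementExtension ℓ K L y) = 0 := by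
    have h1 := map_mem_torsion (divisor ℓ L) hy
    obtain ⟨k, hk⟩ := mem_torsion_iff_exists_pow.1 h1
    exact (smul_eq_zero.1 hk).resolve_left (pow_ne_zero _ PadicInt.prime_p.ne_zero)
  rw [map_sub, hd, divisor_elementExtension, sub_eq_zero] at h0
  rw [Submodule.mem_bot, Submodule.Quotient.mk_eq_zero]
  exact ⟨y, mem_pseudoInfinitesimals_of_elementExtension hy', (divisorExtension_injective h0).symm⟩

/-- Galois descent: `R_L^G = R_K`. -/
theorem exists_elementExtension_eq [IsGalois K L] {x : RGlob ℓ L}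
    (hx : ∀ σ : Gal(L/K), embeddingMap ℓ (σ : L →ₐ[K] L) x = x) :
    ∃ y : RGlob ℓ K, elementExtension ℓ K L y = x := by
  refine exists_tensorMap_eq_of_invariant
    (fun σ : Gal(L/K) => Units.map ((σ : L →ₐ[K] L) : L →* L))
    (Units.map (algebraMap K L : K →* L)) (fun b hb => ?_)
    (fun a σ => Units.ext (σ.commutes (a : K))) hx
  obtain ⟨a, ha⟩ := (IsGalois.mem_range_algebraMap_iff_fixed (F := K) (b : L)).2
    fun σ => congrArg Units.val (hb σ)
  have ha0 : a ≠ 0 := by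
    rintro rfl
    exact b.ne_zero (by rw [← ha, map_zero])
  exact ⟨Units.mk0 a ha0, Units.ext ha⟩

end Capitulation

/-! ### Extensions of `ℓ`-power degree of fields without `ℓ`-th roots of unity -/

section NoRoots

variable {ℓ : ℕ} [Fact ℓ.Prime] {K L : Type*} [Field K] [Field L] [Algebra K L]

/-- If `L` contains a primitive `ℓ`-th root of unity, the `ℓ`-group `Gal(L/K)` acts on it through
a group of order `ℓ - 1`, hence trivially, so that it lies in `K`. -/
theorem exists_isPrimitiveRoot_of_isPGroup [FiniteDimensional K L] [IsGalois K L]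
    (hG : IsPGroup ℓ Gal(L/K)) {ζ : L} (hζ : IsPrimitiveRoot ζ ℓ) :
    ∃ ζ' : K, IsPrimitiveRoot ζ' ℓ := by
  have hfix : ∀ σ : Gal(L/K), σ ζ = ζ := by
    intro σ
    obtain ⟨k, hk⟩ := hG σ
    have h1 : hζ.autToPow K σ ^ ℓ ^ k = 1 := by rw [← map_pow, hk, map_one]
    have h2 : hζ.autToPow K σ ^ (ℓ - 1) = 1 := ZMod.units_pow_card_sub_one_eq_one ℓ _
    have hcop : Nat.Coprime (ℓ ^ k) (ℓ - 1) := by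
      refine Nat.Coprime.pow_left _ ((Nat.coprime_self_sub_right ?_).2 ?_)
      · exact (Fact.out : ℓ.Prime).one_lt.le
      · exact Nat.coprime_one_right ℓ
    have h3 : hζ.autToPow K σ = 1 := by
      have := pow_gcd_eq_one.2 ⟨h1, h2⟩
      rwa [hcop.gcd_eq_one, pow_one] at this
    rw [← hζ.autToPow_spec K σ, h3, Units.val_one, ZMod.val_one, pow_one]
  obtain ⟨a, rfl⟩ := (IsGalois.mem_range_algebraMap_iff_fixed (F := K) ζ).2 hfix
  exact ⟨a, hζ.of_map_of_injective (algebraMap K L).injective⟩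

theorem torsion_eq_bot_of_not_exists_isPrimitiveRoot (h : ¬ ∃ ζ : L, IsPrimitiveRoot ζ ℓ) :
    Submodule.torsion ℤ_[ℓ] (AdicTensor ℓ Lˣ) = ⊥ := by
  rw [eq_bot_iff]
  intro x hx
  obtain ⟨k, hk⟩ := mem_torsion_iff_exists_pow.1 hx
  obtain ⟨ζ, hζ, rfl⟩ := exists_eq_one_tmul_of_smul_eq_zero hk
  obtain ⟨j, -, hj⟩ := (Nat.dvd_prime_pow Fact.out).1 (orderOf_dvd_of_pow_eq_one hζ)
  obtain _ | j := j
  · rw [pow_zero, orderOf_eq_one_iff] at hj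
    rw [hj, ofMul_one, TensorProduct.tmul_zero]
    exact Submodule.zero_mem _
  · refine absurd ⟨((ζ ^ ℓ ^ j : Lˣ) : L), IsPrimitiveRoot.coe_units_iff.2 ?_⟩ h
    refine (IsPrimitiveRoot.orderOf ζ).pow (orderOf_pos_iff.2 (isOfFinOrder_iff_pow_eq_one.2
      ⟨ℓ ^ k, pow_pos (Fact.out : ℓ.Prime).pos _, hζ⟩)) ?_
    rw [hj, pow_succ]

end NoRoots

/-! ### Cyclotomic layers -/

section Cyclotomic

variable {ℓ : ℕ} [Fact ℓ.Prime]

/-- Vanishing of the first cohomology group of the subgroup generated by `c ≡ 1 mod ℓ` in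
`(ℤ/ℓ^n)ˣ`, acting on `ℤ/ℓ^n`, when `ℓ` is odd: an element killed by the norm is a multiple of
`c - 1`. With `c - 1` of valuation `k` and a group of order `ℓ ^ r`, the norm
`(c ^ ℓ ^ r - 1) / (c - 1)` has valuation `r` and `k + r ≤ n`. -/
theorem exists_eq_sub_one_mul_of_dvd_mul_geom_sum (hℓ : ℓ ≠ 2) {n N : ℕ} {c a : ℤ}
    (hc : (ℓ : ℤ) ∣ c - 1) (hN : ∀ j : ℕ, (ℓ : ℤ) ^ n ∣ c ^ j - 1 ↔ N ∣ j)
    (ha : (ℓ : ℤ) ^ n ∣ a * ∑ i ∈ Finset.range N, c ^ i) :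
    ∃ t : ℤ, (ℓ : ℤ) ^ n ∣ a - (c - 1) * t := by
  have hp : ℓ.Prime := Fact.out
  have hpZ : Prime (ℓ : ℤ) := Nat.prime_iff_prime_int.1 hp
  have hodd : Odd ℓ := hp.odd_of_ne_two hℓ
  have hc' : ¬ (ℓ : ℤ) ∣ c := fun h => hpZ.not_dvd_one (by simpa using dvd_sub h hc)
  have lte : ∀ j : ℕ, emultiplicity (ℓ : ℤ) (c ^ ℓ ^ j - 1) =
      emultiplicity (ℓ : ℤ) (c - 1) + j := by
    intro j
    have := Int.emultiplicity_pow_sub_pow hp hodd (x := c) (y := 1) hc hc' (ℓ ^ j)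
    rwa [one_pow, hp.emultiplicity_pow_self] at this
  obtain rfl | hN1 := eq_or_ne N 1
  · exact ⟨0, by simpa using ha⟩
  have hc1 : c - 1 ≠ 0 := by
    intro h0
    exact hN1 (Nat.dvd_one.1 ((hN 1).1 (by rw [pow_one, h0]; exact dvd_zero _)))
  have hfin : FiniteMultiplicity (ℓ : ℤ) (c - 1) :=
    Int.finiteMultiplicity_iff.2 ⟨by simpa using hp.ne_one, hc1⟩
  obtain ⟨u, hu, hu'⟩ := hfin.exists_eq_pow_mul_and_not_dvd
  set k := multiplicity (ℓ : ℤ) (c - 1) with hk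
  rw [hfin.emultiplicity_eq_multiplicity, ← hk] at lte
  obtain ⟨r, -, rfl⟩ : ∃ r, r ≤ n ∧ N = ℓ ^ r := by
    refine (Nat.dvd_prime_pow hp).1 ((hN _).1 (pow_dvd_of_le_emultiplicity ?_))
    rw [lte]
    exact_mod_cast Nat.le_add_left n k
  obtain _ | r := r
  · exact absurd (pow_zero ℓ) hN1
  have hkr : k + (r + 1) ≤ n := by
    by_contra hlt
    have h1 : (ℓ : ℤ) ^ n ∣ c ^ ℓ ^ r - 1 := by
      refine pow_dvd_of_le_emultiplicity ?_
      rw [lte]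
      exact_mod_cast (by omega : n ≤ k + r)
    have h2 := (Nat.pow_dvd_pow_iff_le_right hp.one_lt).1 ((hN _).1 h1)
    omega
  have hS : (c - 1) * ∑ i ∈ Finset.range (ℓ ^ (r + 1)), c ^ i = c ^ ℓ ^ (r + 1) - 1 :=
    mul_geom_sum c _
  set S := ∑ i ∈ Finset.range (ℓ ^ (r + 1)), c ^ i
  have hSr : ¬ (ℓ : ℤ) ^ (r + 1 + 1) ∣ S := by
    intro h
    have h1 : (ℓ : ℤ) ^ (k + (r + 1) + 1) ∣ c ^ ℓ ^ (r + 1) - 1 := by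
      rw [← hS, hu, add_assoc, pow_add]
      exact mul_dvd_mul (Dvd.intro _ rfl) h
    have h2 := le_emultiplicity_of_pow_dvd h1
    rw [lte] at h2
    have h3 : k + (r + 1) + 1 ≤ k + (r + 1) := by exact_mod_cast h2
    omega
  have hka : (ℓ : ℤ) ^ k ∣ a := by
    by_contra hna
    have h1 := emultiplicity_lt_iff_not_dvd.2 hna
    have h2 := emultiplicity_lt_iff_not_dvd.2 hSr
    have h3 := le_emultiplicity_of_pow_dvd ha
    rw [emultiplicity_mul hpZ] at h3
    lift emultiplicity (ℓ : ℤ) a to ℕ using h1.ne_top with x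
    lift emultiplicity (ℓ : ℤ) S to ℕ using h2.ne_top with y
    norm_cast at h1 h2 h3
    omega
  obtain ⟨b, rfl⟩ := hka
  have hcop : IsCoprime u ((ℓ : ℤ) ^ n) :=
    (((Prime.coprime_iff_not_dvd hpZ).2 hu').pow_left).symm
  obtain ⟨x, y, hxy⟩ := hcop
  refine ⟨b * x, (ℓ : ℤ) ^ k * b * y, ?_⟩
  rw [hu]
  linear_combination (-(ℓ : ℤ) ^ k * b) * hxy

end Cyclotomic

section CyclotomicDescent

variable {ℓ : ℕ} [Fact ℓ.Prime] {K M : Type*} [Field K] [NumberField K] [Field M] [NumberField M]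
  [Algebra K M]

theorem isCyclic_of_isCyclotomicExtension (hℓ : ℓ ≠ 2) (n : ℕ) [IsCyclotomicExtension {ℓ ^ n} K M] :
    IsCyclic Gal(M/K) := by
  have hp : ℓ.Prime := Fact.out
  have : NeZero (ℓ ^ n) := ⟨pow_ne_zero _ hp.ne_zero⟩
  have := ZMod.isCyclic_units_of_prime_pow ℓ hp hℓ n
  exact isCyclic_of_injective _
    ((IsCyclotomicExtension.zeta_spec (ℓ ^ n) K M).autToPow_injective K)

theorem embeddingMap_one_tmul {L : Type*} [Field L] [Algebra K L] (f : L →ₐ[K] M) (u : Lˣ) :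
    embeddingMap ℓ f ((1 : ℤ_[ℓ]) ⊗ₜ[ℤ] Additive.ofMul u) =
      (1 : ℤ_[ℓ]) ⊗ₜ[ℤ] Additive.ofMul (Units.map (f : L →* M) u) := rfl

/-- Descent modulo torsion in a cyclotomic extension `M = K(ζ)`, `ζ` of order `ℓ ^ n`, with `K`
containing the `ℓ`-th roots of unity: if the Galois group moves `z` by elements of the group
generated by `ζ`, then `z` comes from `R_K` up to torsion. -/
theorem exists_sub_elementExtension_mem_torsion (hℓ : ℓ ≠ 2) {n : ℕ} (hn : n ≠ 0)
    [IsCyclotomicExtension {ℓ ^ n} K M] (hK : ∃ ζ : K, IsPrimitiveRoot ζ ℓ) {z : RGlob ℓ M}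
    (hz : ∀ σ : Gal(M/K), ∃ η : Mˣ, η ^ ℓ ^ n = 1 ∧
      embeddingMap ℓ (σ : M →ₐ[K] M) z - z = (1 : ℤ_[ℓ]) ⊗ₜ[ℤ] Additive.ofMul η) :
    ∃ y : RGlob ℓ K, z - elementExtension ℓ K M y ∈ Submodule.torsion ℤ_[ℓ] (RGlob ℓ M) := by
  have hp : ℓ.Prime := Fact.out
  have hne : NeZero (ℓ ^ n) := ⟨pow_ne_zero _ hp.ne_zero⟩
  have hfd : FiniteDimensional K M := IsCyclotomicExtension.finiteDimensional {ℓ ^ n} K M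
  have hgal : IsGalois K M := IsCyclotomicExtension.isGalois {ℓ ^ n} K M
  have hcyc : IsCyclic Gal(M/K) := isCyclic_of_isCyclotomicExtension hℓ n
  have hμ := IsCyclotomicExtension.zeta_spec (ℓ ^ n) K M
  obtain ⟨ζ, hζμ⟩ := hμ.isUnit (pow_ne_zero _ hp.ne_zero)
  have hζ : IsPrimitiveRoot ζ (ℓ ^ n) := IsPrimitiveRoot.coe_units_iff.1 (hζμ ▸ hμ)
  obtain ⟨h, hgen⟩ := hcyc.exists_generator
  set c : ℤ := ((hμ.autToPow K h : ZMod (ℓ ^ n)).val : ℤ) with hc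
  have hact : Units.map ((h : M →ₐ[K] M) : M →* M) ζ = ζ ^ c := by
    refine Units.ext ?_
    change h (ζ : M) = _
    rw [hc, zpow_natCast, Units.val_pow_eq_pow_val, hζμ]
    exact (hμ.autToPow_spec K h).symm
  have hact' : ∀ a : ℤ, embeddingMap ℓ (h : M →ₐ[K] M)
      ((1 : ℤ_[ℓ]) ⊗ₜ[ℤ] Additive.ofMul (ζ ^ a)) =
        (1 : ℤ_[ℓ]) ⊗ₜ[ℤ] Additive.ofMul (ζ ^ (c * a)) := by
    intro a
    rw [embeddingMap_one_tmul, map_zpow, hact, ← zpow_mul]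
  have hc1 : (ℓ : ℤ) ∣ c - 1 := by
    obtain ⟨ξ, hξ⟩ := hK
    -- `ζ ^ ℓ ^ (n - 1)` is a power of the image of `ξ`, hence fixed by `h`
    have h1 : (((ζ : M) ^ ℓ ^ (n - 1)) ^ ℓ) = 1 := by
      rw [← pow_mul, ← pow_succ, Nat.sub_add_cancel (Nat.pos_of_ne_zero hn), hζμ, hμ.pow_eq_one]
    have : NeZero ℓ := ⟨hp.ne_zero⟩
    obtain ⟨i, -, hi⟩ :=
      (hξ.map_of_injective (algebraMap K M).injective).eq_pow_of_pow_eq_one h1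
    have h2 : Units.map ((h : M →ₐ[K] M) : M →* M) (ζ ^ (ℓ ^ (n - 1))) = ζ ^ (ℓ ^ (n - 1)) := by
      refine Units.ext ?_
      change h ((ζ ^ (ℓ ^ (n - 1)) : Mˣ) : M) = _
      rw [Units.val_pow_eq_pow_val, ← hi, ← map_pow, h.commutes]
    rw [map_pow, hact, ← zpow_natCast, ← zpow_natCast, ← zpow_mul, ← div_eq_one, div_eq_mul_inv,
      ← zpow_sub,
      hζ.zpow_eq_one_iff_dvd] at h2
    have h3 : ((ℓ ^ n : ℕ) : ℤ) = (ℓ : ℤ) * (ℓ : ℤ) ^ (n - 1) := by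
      rw [← pow_succ', Nat.sub_add_cancel (Nat.pos_of_ne_zero hn), Nat.cast_pow]
    rw [h3, Nat.cast_pow, show c * (ℓ : ℤ) ^ (n - 1) - (ℓ : ℤ) ^ (n - 1) =
      (c - 1) * (ℓ : ℤ) ^ (n - 1) by ring] at h2
    exact Int.dvd_of_mul_dvd_mul_right (pow_ne_zero _ (Nat.cast_ne_zero.2 hp.ne_zero)) h2
  have hcord : ∀ j : ℕ, (ℓ : ℤ) ^ n ∣ c ^ j - 1 ↔ orderOf h ∣ j := by
    intro j
    rw [orderOf_dvd_iff_pow_eq_one, ← (hμ.autToPow_injective K).eq_iff, map_pow, map_one,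
      ← Units.val_inj, Units.val_pow_eq_pow_val, Units.val_one, ← sub_eq_zero, ← Nat.cast_pow,
      ← ZMod.intCast_zmod_eq_zero_iff_dvd]
    rw [hc]
    push_cast
    rw [ZMod.natCast_zmod_val]
  obtain ⟨η, hη, hzη⟩ := hz h
  obtain ⟨a, ha⟩ : ∃ a : ℤ, ζ ^ a = η := by
    obtain ⟨i, -, hi⟩ := hμ.eq_pow_of_pow_eq_one (ξ := (η : M))
      (by rw [← Units.val_pow_eq_pow_val, hη, Units.val_one])
    exact ⟨i, Units.ext (by rw [zpow_natCast, Units.val_pow_eq_pow_val, hζμ, hi])⟩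
  rw [← ha] at hzη
  have hpow : ∀ j : ℕ, embeddingMap ℓ ((h ^ j : Gal(M/K)) : M →ₐ[K] M) z =
      z + (1 : ℤ_[ℓ]) ⊗ₜ[ℤ] Additive.ofMul (ζ ^ (a * ∑ i ∈ Finset.range j, c ^ i)) := by
    intro j
    induction j with
    | zero =>
      rw [Finset.sum_range_zero, mul_zero, zpow_zero, ofMul_one, TensorProduct.tmul_zero, add_zero]
      exact tensorMap_id z
    | succ j ih =>
      have e : embeddingMap ℓ ((h ^ (j + 1) : Gal(M/K)) : M →ₐ[K] M) z =
          embeddingMap ℓ (h : M →ₐ[K] M)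
            (embeddingMap ℓ ((h ^ j : Gal(M/K)) : M →ₐ[K] M) z) := by
        rw [pow_succ', embeddingMap, embeddingMap, embeddingMap, tensorMap_comp]
        rfl
      rw [e, ih, map_add, hact', sub_eq_iff_eq_add'.1 hzη, geom_sum_succ, add_assoc,
        ← TensorProduct.tmul_add, ← ofMul_mul, ← zpow_add]
      congr 4
      ring
  -- the order of `h` gives `h ^ orderOf h • z = z`, that is, `ζ ^ a` has norm `1`
  have hnorm : (ℓ : ℤ) ^ n ∣ a * ∑ i ∈ Finset.range (orderOf h), c ^ i := by
    have h1 := hpow (orderOf h)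
    rw [pow_orderOf_eq_one] at h1
    have h2 : embeddingMap ℓ ((1 : Gal(M/K)) : M →ₐ[K] M) z = z := tensorMap_id z
    rw [h2, left_eq_add] at h1
    have h3 := eq_one_of_one_tmul_eq_zero (k := n) (by
      rw [← zpow_natCast, ← zpow_mul, mul_comm, zpow_mul, zpow_natCast, hζ.pow_eq_one,
        one_zpow]) h1
    rw [hζ.zpow_eq_one_iff_dvd] at h3
    exact_mod_cast h3
  -- hence `ζ ^ a = h (ζ ^ t) / ζ ^ t`, and `z` may be corrected by `ζ ^ t`
  obtain ⟨t, ht⟩ := exists_eq_sub_one_mul_of_dvd_mul_geom_sum hℓ hc1 hcord hnorm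
  have hfix : embeddingMap ℓ (h : M →ₐ[K] M) (z - (1 : ℤ_[ℓ]) ⊗ₜ[ℤ] Additive.ofMul (ζ ^ t)) =
      z - (1 : ℤ_[ℓ]) ⊗ₜ[ℤ] Additive.ofMul (ζ ^ t) := by
    have h1 : ζ ^ a = ζ ^ (c * t) / ζ ^ t := by
      rw [div_eq_mul_inv, ← zpow_sub, ← div_eq_one, div_eq_mul_inv, ← zpow_sub,
        hζ.zpow_eq_one_iff_dvd]
      rw [Nat.cast_pow, show a - (c * t - t) = a - (c - 1) * t by ring]
      exact ht
    rw [map_sub, hact', sub_eq_iff_eq_add'.1 hzη, h1, ofMul_div, TensorProduct.tmul_sub]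
    abel
  obtain ⟨y, hy⟩ := exists_elementExtension_eq (K := K) (L := M)
    (x := z - (1 : ℤ_[ℓ]) ⊗ₜ[ℤ] Additive.ofMul (ζ ^ t)) (fun σ => by
      obtain ⟨j, rfl⟩ : ∃ j : ℕ, h ^ j = σ := mem_powers_iff_mem_zpowers.2 (hgen σ)
      induction j with
      | zero => exact tensorMap_id _
      | succ j ih =>
        conv_rhs => rw [← hfix, ← ih]
        rw [pow_succ', embeddingMap, embeddingMap, embeddingMap, tensorMap_comp]
        rfl)
  refine ⟨y, ?_⟩
  rw [hy, sub_sub_cancel]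
  refine one_tmul_mem_torsion (k := n) ?_
  rw [← zpow_natCast, ← zpow_mul, mul_comm, zpow_mul, zpow_natCast, hζ.pow_eq_one, one_zpow]

end CyclotomicDescent

section Layer

variable {ℓ : ℕ} [Fact ℓ.Prime] {K L : Type*} [Field K] [Field L] [Algebra K L]

/-- A finite extension of `K` inside `K(μ_{ℓ^∞})` is contained in all the fields `K(ζ)`, `ζ` a
primitive `ℓ ^ n`-th root of unity, with `n` large enough. -/
theorem exists_fieldRange_le_adjoin [FiniteDimensional K L] (φ : L →ₐ[K] AlgebraicClosure K)
    (h : φ.fieldRange ≤ cyclotomicTower ℓ K) :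
    ∃ m : ℕ, ∀ n, m ≤ n → ∀ ζ : AlgebraicClosure K, IsPrimitiveRoot ζ (ℓ ^ n) →
      φ.fieldRange ≤ IntermediateField.adjoin K {ζ} := by
  have step : ∀ x ∈ cyclotomicTower ℓ K, ∃ m : ℕ, ∀ n, m ≤ n → ∀ ζ : AlgebraicClosure K,
      IsPrimitiveRoot ζ (ℓ ^ n) → x ∈ IntermediateField.adjoin K {ζ} := by
    intro x hx
    obtain ⟨T, hT, hxT⟩ := IntermediateField.exists_finset_of_mem_adjoin hx
    have hT' : ∀ ξ ∈ T, ∃ k : ℕ, ξ ^ ℓ ^ k = 1 := fun ξ hξ => hT hξ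
    choose! k hk using hT'
    refine ⟨T.sup k, fun n hn ζ hζ => ?_⟩
    refine (IntermediateField.adjoin_le_iff.2 fun ξ hξ => ?_ :
      IntermediateField.adjoin K (T : Set (AlgebraicClosure K)) ≤ _) hxT
    have h1 : ξ ^ ℓ ^ n = 1 := by
      obtain ⟨d, hd⟩ := pow_dvd_pow ℓ ((Finset.le_sup (f := k) hξ).trans hn : k ξ ≤ n)
      rw [hd, pow_mul, hk ξ hξ, one_pow]
    have : NeZero (ℓ ^ n) := ⟨pow_ne_zero _ (Fact.out : ℓ.Prime).ne_zero⟩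
    obtain ⟨i, -, rfl⟩ := hζ.eq_pow_of_pow_eq_one h1
    exact pow_mem (IntermediateField.mem_adjoin_simple_self K ζ) i
  let b := Module.finBasis K L
  have hb : ∀ i, ∃ m : ℕ, ∀ n, m ≤ n → ∀ ζ : AlgebraicClosure K,
      IsPrimitiveRoot ζ (ℓ ^ n) → φ (b i) ∈ IntermediateField.adjoin K {ζ} :=
    fun i => step _ (h ⟨b i, rfl⟩)
  choose m hm using hb
  refine ⟨Finset.univ.sup m, fun n hn ζ hζ => ?_⟩
  rintro _ ⟨x, rfl⟩
  change φ x ∈ _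
  rw [← b.sum_repr x, map_sum]
  refine sum_mem fun i _ => ?_
  rw [map_smul]
  exact IntermediateField.smul_mem _ (hm i n ((Finset.le_sup (Finset.mem_univ i)).trans hn) ζ hζ)

end Layer

end PseudoInfinitesimal

/-! ### Triviality of the capitulation -/

open PseudoInfinitesimal in
theorem mainTheorem5 (ℓ : ℕ) [Fact ℓ.Prime] (hℓ : ℓ ≠ 2)
    (K L : Type*) [Field K] [NumberField K] [Field L] [NumberField L] [Algebra K L]
    [IsGalois K L] (hG : IsPGroup ℓ Gal(L/K))
    (hLeopoldt : PseudoInfinitesimal.LeopoldtConjecture ℓ L) :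
    ((¬ ∃ ζ : K, IsPrimitiveRoot ζ ℓ) → PseudoInfinitesimal.capitulation ℓ K L = ⊥) ∧
    ((∃ ζ : K, IsPrimitiveRoot ζ ℓ) → PseudoInfinitesimal.IsCyclotomicLayer ℓ K L →
      PseudoInfinitesimal.capitulation ℓ K L = ⊥) := by
  have hp : ℓ.Prime := Fact.out
  have htors : ∀ {x : RGlob ℓ L}, x ∈ pseudoInfinitesimals ℓ L → ∀ {d : Divisors ℓ K},
      divisor ℓ L x = divisorExtension ℓ K L d → ∀ σ : Gal(L/K),
      embeddingMap ℓ (σ : L →ₐ[K] L) x - x ∈ Submodule.torsion ℤ_[ℓ] (RGlob ℓ L) := by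
    intro x hx d hd σ
    have := embeddingMap_sub_mem_torsion hLeopoldt (σ : L →ₐ[K] L) (AlgHom.id K L) hx hd
    rwa [show embeddingMap ℓ (AlgHom.id K L) x = x from tensorMap_id x] at this
  refine ⟨fun hK => ?_, fun hK hlayer => ?_⟩
  · have hT := torsion_eq_bot_of_not_exists_isPrimitiveRoot (ℓ := ℓ) (L := L)
      fun ⟨_, hζ⟩ => hK (exists_isPrimitiveRoot_of_isPGroup hG hζ)
    refine capitulation_eq_bot fun x hx d hd => ?_
    obtain ⟨y, hy⟩ := exists_elementExtension_eq (K := K) (x := x) fun σ => by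
      have := htors hx hd σ
      rwa [hT, Submodule.mem_bot, sub_eq_zero] at this
    exact ⟨y, by rw [hy, sub_self]; exact Submodule.zero_mem _⟩
  · obtain ⟨-, C, ⟨hC, -⟩, φ, hφ⟩ := hlayer
    refine capitulation_eq_bot fun x hx d hd => ?_
    have h1 : ∀ σ : Gal(L/K), ∃ (k : ℕ) (η : Lˣ), η ^ ℓ ^ k = 1 ∧
        embeddingMap ℓ (σ : L →ₐ[K] L) x - x = (1 : ℤ_[ℓ]) ⊗ₜ[ℤ] Additive.ofMul η := fun σ => by
      obtain ⟨k, hk⟩ := mem_torsion_iff_exists_pow.1 (htors hx hd σ)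
      exact ⟨k, exists_eq_one_tmul_of_smul_eq_zero hk⟩
    choose k η hη hxη using h1
    obtain ⟨m, hm⟩ := exists_fieldRange_le_adjoin φ (hφ.trans hC)
    -- `K(ζ)` contains `L`, and its roots of unity of order dividing `ℓ ^ n` include all `η σ`
    obtain ⟨N, hN⟩ := (Set.finite_range k).bddAbove
    let n := max (max m N) 1
    have hn : NeZero (ℓ ^ n) := ⟨pow_ne_zero _ hp.ne_zero⟩
    obtain ⟨ζ, hζ⟩ := HasEnoughRootsOfUnity.exists_primitiveRoot (AlgebraicClosure K) (ℓ ^ n)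
    let M := IntermediateField.adjoin K {ζ}
    have hcyc : IsCyclotomicExtension {ℓ ^ n} K M :=
      hζ.intermediateField_adjoin_isCyclotomicExtension K
    have : NumberField M := IsCyclotomicExtension.numberField {ℓ ^ n} K M
    let f : L →ₐ[K] M := φ.codRestrict M.toSubalgebra fun l =>
      hm n ((le_max_left _ _).trans (le_max_left _ _)) ζ hζ ⟨l, rfl⟩
    have hres : ∀ τ : Gal(M/K), ∃ σ : Gal(L/K), ∀ l, f (σ l) = τ (f l) := by
      intro τ
      let _ : Algebra L M := f.toRingHom.toAlgebra
      have : IsScalarTower K L M := IsScalarTower.of_algebraMap_eq fun a => (f.commutes a).symm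
      exact ⟨τ.restrictNormal L, fun l => τ.restrictNormal_commutes L l⟩
    -- the conjecture is not assumed for `M`: the cocycle of the image of `x` in `R_M` is inflated
    -- from that of `x`, as `L` is normal over `K`
    obtain ⟨y, hy⟩ := exists_sub_elementExtension_mem_torsion (K := K) (M := M) (n := n) hℓ
      (by omega) hK (z := embeddingMap ℓ f x) fun τ => by
        obtain ⟨σ, hσ⟩ := hres τ
        refine ⟨Units.map (f : L →* M) (η σ), ?_, ?_⟩
        · obtain ⟨e, he⟩ := pow_dvd_pow ℓ (show k σ ≤ n from
            (hN ⟨σ, rfl⟩).trans ((le_max_right _ _).trans (le_max_left _ _)))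
          rw [← map_pow, he, pow_mul, hη, one_pow, map_one]
        · rw [← embeddingMap_one_tmul, ← hxη, map_sub]
          congr 1
          rw [embeddingMap, embeddingMap, embeddingMap, tensorMap_comp, tensorMap_comp]
          congr 1
          congr 1
          exact MonoidHom.ext fun u => Units.ext (hσ u).symm
    refine ⟨y, mem_torsion_of_map_injective (embeddingMap_injective f) ?_⟩
    rwa [map_sub, embeddingMap_elementExtension]
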